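/- Let $C>0$ and let $f:\mathbb R\to\mathbb R$ be a differentiable link function such that, for $|x|\le C^2$, $0<f(x)<1$ and $f'(x)\neq 0$, and $$\sup_{|x|\le C^2}\frac{|f'(x)|}{f(x)(1-f(x))}<\infty,\qquad \sup_{|x|\le C^2}\frac{f(x)(1-f(x))}{(f'(x))^2}<\infty .$$ For $N,J\ge 1$ and $K\ge 0$, parameters are triples $(\Theta,A,\mathbf d)$, where $\Theta\in\mathbb R^{N\times K}$ has rows $\boldsymbol\theta_i^\top$, $A\in\mathbb R^{J\times K}$ has rows $\mathbf a_j^\top$, and $\mathbf d\in\mathbb R^J$. Call $(\Theta,A,\mathbf d)$ feasible if $\sqrt{1+\|\boldsymbol\theta_i\|^2}\le C$ for all $i\le N$ and $\sqrt{d_j^2+\|\mathbf a_j\|^2}\le C$ for all $j\le J$ (Euclidean norms). For responses $y\in\{0,1\}^{N\times J}$, a constrained joint maximum likelihood estimate (CJMLE) is any maximizer, over the feasible triples, of $\log L$, where $$L(\Theta,A,\mathbf d)=\prod_{i=1}^N\prod_{j=1}^J f(d_j+\mathbf a_j^\top\boldsymbol\theta_i)^{y_{ij}}\bigl(1-f(d_j+\mathbf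 a_j^\top\boldsymbol\theta_i)\bigr)^{1-y_{ij}} .$$ Then there are constants $C_1,C_2>0$, depending only on $C$ and the given link $f$ (in particular not on $N$, $J$, $K$ or the true parameters), such that the following holds for all $N,J\ge1$, all $K$, and every feasible true parameter $(\Theta^*,A^*,\mathbf d^*)$. If $Y_{ij}$ ($i\le N$, $j\le J$) are independent $\{0,1\}$-valued random variables with $P(Y_{ij}=1)=f(d_j^*+(\mathbf a_j^*)^\top\boldsymbol\theta_i^*)$, then a CJMLE exists for every $y\in\{0,1\}^{N\times J}$, and with probability at least $1-C_1/(N+J)$ every CJMLE $(\hat\Theta,\hat A,\hat{\mathbf d})$ computed from $(Y_{ij})$ satisfies $$\frac1{NJ}\bigl\|\hat\Theta\hat A^\top+\mathbf 1_N\hat{\mathbf d}^\top-\Theta^*(A^*)^\top-\mathbf 1_N(\mathbf d^*)^\top\bigr\|_F^2\le C_2\sqrt{\frac{J+N}{NJ}},$$ where $\|\cdot\|_F$ is the Frobenius norm and $\mathbf 1_N$ is the all-ones vector in $\mathbb R^N$. -/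

import Mathlib

/-- The parameters of an item factor analysis model with `N` respondents, `J` items and `K` latent
factors: person parameters `Θ` (row `i` is `θ_i`), loadings `A` (row `j` is `a_j`) and
intercepts `d`. -/
structure IFAParams (N J K : ℕ) where
  Θ : Matrix (Fin N) (Fin K) ℝ
  A : Matrix (Fin J) (Fin K) ℝ
  d : Fin J → ℝ

/-- The matrix `Θ Aᵀ + 1_N dᵀ`, whose `(i, j)` entry is `d_j + a_jᵀ θ_i`. -/
noncomputable def IFAParams.predictor {N J K : ℕ} (ψ : IFAParams N J K) :
    Matrix (Fin N) (Fin J) ℝ :=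
  ψ.Θ * ψ.A.transpose + Matrix.vecMulVec (fun _ => 1) ψ.d

/-- The constraint set `√(1 + ‖θ_i‖²) ≤ C`, `√(d_j² + ‖a_j‖²) ≤ C` for all `i`, `j`
(Euclidean norms). -/
def feasibleSet (N J K : ℕ) (C : ℝ) : Set (IFAParams N J K) :=
  {ψ | (∀ i, √(1 + ‖WithLp.toLp 2 (ψ.Θ i)‖ ^ 2) ≤ C) ∧
       (∀ j, √((ψ.d j) ^ 2 + ‖WithLp.toLp 2 (ψ.A j)‖ ^ 2) ≤ C)}

/-- The joint likelihood of the dichotomous responses `y`. -/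
noncomputable def jointLik {N J K : ℕ} (f : ℝ → ℝ) (y : Fin N → Fin J → Fin 2)
    (ψ : IFAParams N J K) : ℝ :=
  ∏ i, ∏ j, f (ψ.predictor i j) ^ (y i j : ℕ) * (1 - f (ψ.predictor i j)) ^ (1 - (y i j : ℕ))

/-- `ψ` is a constrained joint maximum likelihood estimate for the responses `y`: a maximizer of
the joint log-likelihood over the constraint set. Maximizers are not unique in general. -/
def IsCJMLE {N J K : ℕ} (f : ℝ → ℝ) (C : ℝ) (y : Fin N → Fin J → Fin 2)
    (ψ : IFAParams N J K) : Prop :=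
  ψ ∈ feasibleSet N J K C ∧
    IsMaxOn (fun ψ' => Real.log (jointLik f y ψ')) (feasibleSet N J K C) ψ

/-- Regularity of the link function: `f` is differentiable and both
`|f'| / (f (1 - f))` and `f (1 - f) / (f')²` have a finite supremum over `|x| ≤ C²`.
Finiteness of the suprema includes that the denominators do not vanish there (division by zero
is not to be read as zero), where `f (x)` is a probability. -/
structure LinkRegular (f : ℝ → ℝ) (C : ℝ) : Prop where
  differentiable : Differentiable ℝ f
  pos : ∀ x, |x| ≤ C ^ 2 → 0 < f x
  lt_one : ∀ x, |x| ≤ C ^ 2 → f x < 1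
  deriv_ne_zero : ∀ x, |x| ≤ C ^ 2 → deriv f x ≠ 0
  bdd_score : BddAbove ((fun x => |deriv f x| / (f x * (1 - f x))) '' {x | |x| ≤ C ^ 2})
  bdd_inv_info : BddAbove ((fun x => f x * (1 - f x) / (deriv f x) ^ 2) '' {x | |x| ≤ C ^ 2})

/-- The responses `Y i j` follow the model with link `f` and parameters `ψ`: they are independent
`{0, 1}`-valued random variables with `P (Y i j = 1) = f (d_j + a_jᵀ θ_i)`. -/
structure IsIFAModel {N J K : ℕ} {Ω : Type*} [MeasurableSpace Ω] (P : MeasureTheory.Measure Ω)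
    (f : ℝ → ℝ) (ψ : IFAParams N J K) (Y : Fin N → Fin J → Ω → Fin 2) : Prop where
  measurable : ∀ i j, Measurable (Y i j)
  prob_one : ∀ i j, P.real {ω | Y i j ω = 1} = f (ψ.predictor i j)
  indep : ProbabilityTheory.iIndepFun (fun p : Fin N × Fin J => Y p.1 p.2) P

/-- The Frobenius norm of a matrix. -/
noncomputable def frobNorm {N J : ℕ} (X : Matrix (Fin N) (Fin J) ℝ) : ℝ :=
  √(∑ i, ∑ j, X i j ^ 2)

/-! A maximizer's log-likelihood is at least that of the truth, so the total Bernoulli divergence of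
the fitted from the true model is at most a centred fluctuation (`IsCJMLE.sum_bernoulliKL_le`). The
divergence dominates the squared error of the predictors: it controls squared differences of
probabilities, and `|f'|` is bounded away from zero on the compact range
(`LinkRegular.exists_sq_sub_le_bernoulliKL`).

It remains to bound the fluctuation uniformly by order `√(NJ(N+J))`. Inside an exponential moment,
coordinate by coordinate, centred Bernoulli variables are replaced by random signs and the Lipschitz
log-odds by a linear function (`sum_prod_mul_exp_iSup_le`, `bernoulli_exp_iSup_le_rademacher`). The
resulting sign sum is linear in the predictor, hence at most the operator norm of the sign matrix
times `C²√(NJ)`, with no dependence on `K` (`abs_sum_mul_predictor_le`). Norming sets of sizes at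
most `5^N` and `5^J` control the operator norm, and a Chernoff bound finishes. -/

/-! ### Link function and Bernoulli divergence -/

/-- The log-odds `log (f x / (1 - f x))` of the link. -/
noncomputable def logOdds (f : ℝ → ℝ) (x : ℝ) : ℝ := Real.log (f x) - Real.log (1 - f x)

/-- The Kullback-Leibler divergence between Bernoulli distributions. -/
noncomputable def bernoulliKL (p q : ℝ) : ℝ :=
  p * (Real.log p - Real.log q) + (1 - p) * (Real.log (1 - p) - Real.log (1 - q))

/-- This is `log x ≤ x - 1` at `x = √q / √p`; summed over both outcomes it bounds the divergence
below by the squared Hellinger distance. -/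
lemma mul_log_sub_log_ge {p q : ℝ} (hp : 0 < p) (hq : 0 < q) :
    2 * p - 2 * (√p * √q) ≤ p * (Real.log p - Real.log q) := by
  have hp' := Real.sqrt_pos.2 hp
  have hq' := Real.sqrt_pos.2 hq
  have h := Real.log_le_sub_one_of_pos (div_pos hq' hp')
  rw [Real.log_div hq'.ne' hp'.ne', Real.log_sqrt hq.le, Real.log_sqrt hp.le] at h
  have h2 : p * (√q / √p) = √p * √q := by
    nth_rewrite 1 [← Real.mul_self_sqrt hp.le]
    field_simp
  nlinarith [mul_le_mul_of_nonneg_left h hp.le]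

lemma sq_sub_le_bernoulliKL {p q : ℝ} (hp : 0 < p) (hp1 : p < 1) (hq : 0 < q) (hq1 : q < 1) :
    (p - q) ^ 2 ≤ 4 * bernoulliKL p q := by
  have h1 := mul_log_sub_log_ge hp hq
  have h2 := mul_log_sub_log_ge (sub_pos.2 hp1) (sub_pos.2 hq1)
  have h3 : (p - q) ^ 2 ≤ 4 * (√p - √q) ^ 2 := by
    have e : p - q = (√p - √q) * (√p + √q) := by
      rw [mul_comm, ← sq_sub_sq, Real.sq_sqrt hp.le, Real.sq_sqrt hq.le]
    rw [e, mul_pow, mul_comm]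
    have a : √p ≤ 1 := Real.sqrt_le_one.2 hp1.le
    have b : √q ≤ 1 := Real.sqrt_le_one.2 hq1.le
    have : (√p + √q) ^ 2 ≤ 4 := by nlinarith [Real.sqrt_nonneg p, Real.sqrt_nonneg q]
    gcongr
  have h4 := sq_nonneg (√(1 - p) - √(1 - q))
  have e1 : (√p - √q) ^ 2 = p + q - 2 * (√p * √q) := by
    rw [sub_sq, Real.sq_sqrt hp.le, Real.sq_sqrt hq.le]; ring
  have e2 : (√(1 - p) - √(1 - q)) ^ 2 = (1 - p) + (1 - q) - 2 * (√(1 - p) * √(1 - q)) := by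
    rw [sub_sq, Real.sq_sqrt (sub_pos.2 hp1).le, Real.sq_sqrt (sub_pos.2 hq1).le]; ring
  unfold bernoulliKL
  nlinarith

/-- The derivative of the log-odds is `f' / (f (1 - f))`, exactly the quantity bounded by
`bdd_score`. -/
lemma LinkRegular.exists_logOdds_lipschitz {f : ℝ → ℝ} {C : ℝ} (hf : LinkRegular f C) :
    ∃ L : ℝ, 0 < L ∧ ∀ x y, |x| ≤ C ^ 2 → |y| ≤ C ^ 2 →
      |logOdds f x - logOdds f y| ≤ L * |x - y| := by
  obtain ⟨B, hB⟩ := hf.bdd_score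
  refine ⟨max B 1, by positivity, fun x y hx hy => ?_⟩
  have hd : ∀ z ∈ Set.Icc (-C ^ 2) (C ^ 2),
      HasDerivWithinAt (logOdds f) (deriv f z / (f z * (1 - f z))) (Set.Icc (-C ^ 2) (C ^ 2)) z := by
    intro z hz
    have hz' : |z| ≤ C ^ 2 := abs_le.2 hz
    have h0 := hf.pos z hz'
    have h1 := sub_pos.2 (hf.lt_one z hz')
    have hd := (hf.differentiable z).hasDerivAt
    have := (hd.log h0.ne').sub ((hd.const_sub 1).log h1.ne')
    refine (this.congr_deriv ?_).hasDerivWithinAt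
    field_simp
    ring
  have := Convex.norm_image_sub_le_of_norm_hasDerivWithin_le (C := max B 1) hd ?_
    (convex_Icc _ _) (abs_le.1 hy) (abs_le.1 hx)
  · simpa [Real.norm_eq_abs] using this
  · intro z hz
    have hz' : |z| ≤ C ^ 2 := abs_le.2 hz
    have h0 := mul_pos (hf.pos z hz') (sub_pos.2 (hf.lt_one z hz'))
    rw [Real.norm_eq_abs, abs_div, abs_of_pos h0]
    exact (hB ⟨z, hz', rfl⟩).trans (le_max_left _ _)

/-- By compactness `f (1 - f)` has a positive minimum, so `bdd_inv_info` bounds `(f')²` below; the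
mean value theorem does the rest. -/
lemma LinkRegular.exists_abs_sub_ge {f : ℝ → ℝ} {C : ℝ} (hf : LinkRegular f C) :
    ∃ c : ℝ, 0 < c ∧ ∀ x y, |x| ≤ C ^ 2 → |y| ≤ C ^ 2 → c * (x - y) ^ 2 ≤ (f x - f y) ^ 2 := by
  obtain ⟨B, hB⟩ := hf.bdd_inv_info
  have hcont : Continuous f := hf.differentiable.continuous
  obtain ⟨z, hz, hmin⟩ := (isCompact_Icc (a := -C ^ 2) (b := C ^ 2)).exists_isMinOn
    ⟨0, by simp [sq_nonneg]⟩
    (show ContinuousOn (fun x => f x * (1 - f x)) _ by fun_prop)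
  have hz' : |z| ≤ C ^ 2 := abs_le.2 hz
  have hδ := mul_pos (hf.pos z hz') (sub_pos.2 (hf.lt_one z hz'))
  have hB' : 0 < max B 1 := by positivity
  refine ⟨f z * (1 - f z) / max B 1, by positivity, fun x y hx hy => ?_⟩
  have key : ∀ w, |w| ≤ C ^ 2 → f z * (1 - f z) / max B 1 ≤ (deriv f w) ^ 2 := by
    intro w hw
    have h1 : f w * (1 - f w) / (deriv f w) ^ 2 ≤ max B 1 :=
      (hB ⟨w, hw, rfl⟩).trans (le_max_left _ _)
    have h2 := sq_pos_of_ne_zero (hf.deriv_ne_zero w hw)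
    rw [div_le_iff₀ h2] at h1
    rw [div_le_iff₀ hB']
    have h3 : f z * (1 - f z) ≤ f w * (1 - f w) := hmin (abs_le.1 hw)
    linarith
  have main : ∀ x y, |x| ≤ C ^ 2 → |y| ≤ C ^ 2 → x < y →
      f z * (1 - f z) / max B 1 * (x - y) ^ 2 ≤ (f x - f y) ^ 2 := by
    intro x y hx hy hxy
    obtain ⟨w, hw, he⟩ := exists_deriv_eq_slope f hxy hcont.continuousOn
      hf.differentiable.differentiableOn
    have hxy' := sub_pos.2 hxy
    have := key w (abs_le.2 ⟨(abs_le.1 hx).1.trans hw.1.le, hw.2.le.trans (abs_le.1 hy).2⟩)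
    rw [eq_div_iff hxy'.ne'] at he
    calc _ ≤ (deriv f w) ^ 2 * (x - y) ^ 2 := by gcongr
      _ = (deriv f w * (y - x)) ^ 2 := by ring
      _ = _ := by rw [he]; ring
  rcases lt_trichotomy x y with h | h | h
  · exact main x y hx hy h
  · simp [h]
  · have := main y x hy hx h
    rwa [sub_sq_comm x y, sub_sq_comm (f x) (f y)]

lemma LinkRegular.exists_sq_sub_le_bernoulliKL {f : ℝ → ℝ} {C : ℝ} (hf : LinkRegular f C) :
    ∃ c : ℝ, 0 < c ∧ ∀ x y, |x| ≤ C ^ 2 → |y| ≤ C ^ 2 →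
      c * (x - y) ^ 2 ≤ bernoulliKL (f y) (f x) := by
  obtain ⟨c, hc, h⟩ := hf.exists_abs_sub_ge
  refine ⟨c / 4, by positivity, fun x y hx hy => ?_⟩
  have h1 := h x y hx hy
  have h2 := sq_sub_le_bernoulliKL (hf.pos y hy) (hf.lt_one y hy) (hf.pos x hx) (hf.lt_one x hx)
  nlinarith [sub_sq_comm (f x) (f y)]

/-! ### Symmetrization and contraction of exponential moments -/

lemma exp_add_exp_le_of_weak_majorization {x y a b : ℝ} (hsum : x + y ≤ a + b)
    (hx : x ≤ max a b) (hy : y ≤ max a b) :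
    Real.exp x + Real.exp y ≤ Real.exp a + Real.exp b := by
  wlog hab : b ≤ a generalizing a b
  · rw [add_comm (Real.exp a)]
    exact this (by linarith) (by rwa [max_comm]) (by rwa [max_comm]) (le_of_not_ge hab)
  rw [max_eq_left hab] at hx hy
  rcases le_total x b with h | h
  · linarith [Real.exp_le_exp.2 h, Real.exp_le_exp.2 hy]
  -- Raise `y` to `a + b - x`: both pairs of exponentials then have the same product, and the pair
  -- lying between has the smaller sum.
  · have h1 : Real.exp y ≤ Real.exp (a + b - x) := Real.exp_le_exp.2 (by linarith)
    have h2 : Real.exp (a + b - x) * Real.exp x = Real.exp a * Real.exp b := by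
      rw [← Real.exp_add, ← Real.exp_add]; ring_nf
    have h3 := Real.exp_le_exp.2 hx
    have h4 := Real.exp_le_exp.2 h
    have h5 := Real.exp_pos x
    have : 0 ≤ (Real.exp a - Real.exp x) * (Real.exp x - Real.exp b) :=
      mul_nonneg (by linarith) (by linarith)
    have : (Real.exp x + Real.exp (a + b - x)) * Real.exp x
        ≤ (Real.exp a + Real.exp b) * Real.exp x := by nlinarith
    linarith [le_of_mul_le_mul_right this h5]

section TwoPoint

lemma le_ciSup_finite {α : Type*} [Finite α] (F : α → ℝ) (t : α) : F t ≤ ⨆ s, F s :=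
  le_ciSup (Set.finite_range F).bddAbove t

variable {α : Type*} [Finite α] [Nonempty α]

/-- The contraction principle for a single Rademacher variable, in exponential form. -/
lemma exp_iSup_contraction (a g b : α → ℝ) (h0 : ∀ t, |g t| ≤ |b t|)
    (h1 : ∀ s t, |g s - g t| ≤ |b s - b t|) :
    Real.exp (⨆ t, a t + g t) + Real.exp (⨆ t, a t - g t)
      ≤ Real.exp (⨆ t, a t + b t) + Real.exp (⨆ t, a t - b t) := by
  obtain ⟨s, hs⟩ := exists_eq_ciSup_of_finite (f := fun t => a t + g t)
  obtain ⟨t, ht⟩ := exists_eq_ciSup_of_finite (f := fun t => a t - g t)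
  rw [← hs, ← ht]
  have A := le_ciSup_finite (fun t => a t + b t)
  have B := le_ciSup_finite (fun t => a t - b t)
  have As := A s
  have At := A t
  have Bs := B s
  have Bt := B t
  -- For the sum, pair `s` with `+b` and `t` with `-b`, or the reverse, by the sign of `b s - b t`.
  -- Then `h0` puts each single term below the larger supremum.
  apply exp_add_exp_le_of_weak_majorization
  · have := (le_abs_self _).trans (h1 s t)
    rcases abs_cases (b s - b t) with h | h <;> linarith
  · have := (le_abs_self _).trans (h0 s)
    rw [le_max_iff]
    rcases abs_cases (b s) with h | h
    · left; linarith
    · right; linarith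
  · have := (neg_le_abs _).trans (h0 t)
    rw [le_max_iff]
    rcases abs_cases (b t) with h | h
    · left; linarith
    · right; linarith

/-- A centred Bernoulli variable is dominated in the convex order by a Rademacher variable. -/
lemma exp_iSup_bernoulli_le_rademacher (a g : α → ℝ) {p : ℝ} (hp : 0 ≤ p) (hp1 : p ≤ 1) :
    (1 - p) * Real.exp (⨆ t, a t + (0 - p) * g t) + p * Real.exp (⨆ t, a t + (1 - p) * g t)
      ≤ (Real.exp (⨆ t, a t + g t) + Real.exp (⨆ t, a t - g t)) / 2 := by
  set S := ⨆ t, a t + g t with hS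
  set R := ⨆ t, a t - g t with hR
  have A := le_ciSup_finite (fun t => a t + g t)
  have B := le_ciSup_finite (fun t => a t - g t)
  -- The left side is convex in `x`, so it lies below its chord on `[-1, 1]`; averaging the chord
  -- over a mean-zero variable leaves its value at `0`.
  have key : ∀ x : ℝ, -1 ≤ x → x ≤ 1 → Real.exp (⨆ t, a t + x * g t)
      ≤ (1 + x) / 2 * Real.exp S + (1 - x) / 2 * Real.exp R := by
    intro x h1 h2
    have hc := convexOn_exp.2 (Set.mem_univ S) (Set.mem_univ R)
      (show 0 ≤ (1 + x) / 2 by linarith) (show 0 ≤ (1 - x) / 2 by linarith) (by ring)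
    refine le_trans (Real.exp_le_exp.2 (ciSup_le fun t => ?_)) hc
    simp only [smul_eq_mul]
    have := mul_le_mul_of_nonneg_left (A t) (show 0 ≤ (1 + x) / 2 by linarith)
    have := mul_le_mul_of_nonneg_left (B t) (show 0 ≤ (1 - x) / 2 by linarith)
    linarith
  have k0 := mul_le_mul_of_nonneg_left (key (0 - p) (by linarith) (by linarith)) (sub_nonneg.2 hp1)
  have k1 := mul_le_mul_of_nonneg_left (key (1 - p) (by linarith) (by linarith)) hp
  linarith

end TwoPoint

/-- A comparison of exponential moments of suprema of sums of independent terms follows from the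
comparison for each coordinate. -/
lemma sum_prod_mul_exp_iSup_le_fin {α X : Type*} [Fintype X] (n : ℕ)
    (w w' : Fin n → X → ℝ) (hw : ∀ i x, 0 ≤ w i x) (hw' : ∀ i x, 0 ≤ w' i x)
    (g b : Fin n → X → α → ℝ)
    (h : ∀ i (a : α → ℝ), ∑ x, w i x * Real.exp (⨆ t, a t + g i x t)
      ≤ ∑ x, w' i x * Real.exp (⨆ t, a t + b i x t)) (a : α → ℝ) :
    ∑ y : Fin n → X, (∏ i, w i (y i)) * Real.exp (⨆ t, a t + ∑ i, g i (y i) t)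
      ≤ ∑ y : Fin n → X, (∏ i, w' i (y i)) * Real.exp (⨆ t, a t + ∑ i, b i (y i) t) := by
  induction n generalizing a with
  | zero => simp
  | succ n ih =>
    have split : ∀ F : (Fin (n + 1) → X) → ℝ,
        ∑ y, F y = ∑ x : X, ∑ y : Fin n → X, F (Fin.cons x y) := by
      intro F
      rw [← Fintype.sum_prod_type']
      exact (Fintype.sum_equiv (Fin.consEquiv fun _ => X) _ _ fun _ => rfl).symm
    rw [split, split]
    simp only [Fin.prod_univ_succ, Fin.sum_univ_succ, Fin.cons_zero, Fin.cons_succ]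
    -- With coordinate `0` frozen, its term joins the offset `a` and induction replaces the others;
    -- these are then frozen in turn and `h 0` applies.
    calc _ = ∑ x : X, w 0 x * ∑ y : Fin n → X, (∏ i, w i.succ (y i)) *
            Real.exp (⨆ t, (a t + g 0 x t) + ∑ i, g i.succ (y i) t) := by
          simp only [Finset.mul_sum, mul_assoc, add_assoc]
      _ ≤ ∑ x : X, w 0 x * ∑ y : Fin n → X, (∏ i, w' i.succ (y i)) *
            Real.exp (⨆ t, (a t + g 0 x t) + ∑ i, b i.succ (y i) t) := by
          refine Finset.sum_le_sum fun x _ => mul_le_mul_of_nonneg_left ?_ (hw 0 x)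
          exact ih (fun i => w i.succ) (fun i => w' i.succ) (fun i => hw _) (fun i => hw' _)
            (fun i => g i.succ) (fun i => b i.succ) (fun i => h _) _
      _ = ∑ y : Fin n → X, (∏ i, w' i.succ (y i)) * ∑ x : X, w 0 x *
            Real.exp (⨆ t, (a t + ∑ i, b i.succ (y i) t) + g 0 x t) := by
          simp only [Finset.mul_sum]
          rw [Finset.sum_comm]
          refine Finset.sum_congr rfl fun y _ => Finset.sum_congr rfl fun x _ => ?_
          simp only [add_right_comm, mul_left_comm]
      _ ≤ ∑ y : Fin n → X, (∏ i, w' i.succ (y i)) * ∑ x : X, w' 0 x *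
            Real.exp (⨆ t, (a t + ∑ i, b i.succ (y i) t) + b 0 x t) :=
          Finset.sum_le_sum fun y _ => mul_le_mul_of_nonneg_left (h 0 _)
            (Finset.prod_nonneg fun i _ => hw' _ _)
      _ = _ := by
          simp only [Finset.mul_sum]
          rw [Finset.sum_comm]
          refine Finset.sum_congr rfl fun y _ => Finset.sum_congr rfl fun x _ => ?_
          rw [mul_left_comm, ← mul_assoc]
          simp only [add_assoc, add_comm (∑ i, _)]

lemma sum_prod_mul_exp_iSup_le {ι α X : Type*} [Fintype ι] [DecidableEq ι] [Fintype X]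
    (w w' : ι → X → ℝ) (hw : ∀ i x, 0 ≤ w i x) (hw' : ∀ i x, 0 ≤ w' i x)
    (g b : ι → X → α → ℝ)
    (h : ∀ i (a : α → ℝ), ∑ x, w i x * Real.exp (⨆ t, a t + g i x t)
      ≤ ∑ x, w' i x * Real.exp (⨆ t, a t + b i x t)) :
    ∑ y : ι → X, (∏ i, w i (y i)) * Real.exp (⨆ t, ∑ i, g i (y i) t)
      ≤ ∑ y : ι → X, (∏ i, w' i (y i)) * Real.exp (⨆ t, ∑ i, b i (y i) t) := by
  let e := Fintype.equivFin ι
  have tr : ∀ (v : ι → X → ℝ) (k : ι → X → α → ℝ),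
      ∑ y : ι → X, (∏ i, v i (y i)) * Real.exp (⨆ t, ∑ i, k i (y i) t)
      = ∑ y : Fin (Fintype.card ι) → X, (∏ i, v (e.symm i) (y i)) *
          Real.exp (⨆ t, 0 + ∑ i, k (e.symm i) (y i) t) := by
    intro v k
    refine Fintype.sum_equiv (Equiv.arrowCongr e (Equiv.refl X)) _ _ fun y => ?_
    simp only [zero_add]
    change _ = (∏ i, v (e.symm i) (y (e.symm i))) *
      Real.exp (⨆ t, ∑ i, k (e.symm i) (y (e.symm i)) t)
    rw [Equiv.prod_comp e.symm (fun i => v i (y i))]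
    congr 3 with t
    exact (Equiv.sum_comp e.symm (fun i => k i (y i) t)).symm
  rw [tr, tr]
  exact sum_prod_mul_exp_iSup_le_fin _ _ _ (fun i => hw _) (fun i => hw' _) _ _ (fun i => h _)
    fun _ => 0

/-! ### Norming sets and random signs -/

/-- A finite-dimensional Euclidean space has a norming set of at most `5 ^ dim` vectors of norm at
most `2`. -/
lemma exists_norming_finset (E : Type*) [NormedAddCommGroup E] [InnerProductSpace ℝ E]
    [FiniteDimensional ℝ E] :
    ∃ S : Finset E, S.card ≤ 5 ^ Module.finrank ℝ E ∧ (∀ s ∈ S, ‖s‖ ≤ 2) ∧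
      ∀ x : E, ∃ s ∈ S, ‖x‖ ≤ inner ℝ s x := by
  classical
  -- A 1-separated set of maximal size in the ball of radius 2 is a 1-net of that ball.
  let good : Finset E → Prop := fun S =>
    (∀ c ∈ S, ‖c‖ ≤ 2) ∧ ∀ c ∈ S, ∀ d ∈ S, c ≠ d → 1 ≤ ‖c - d‖
  let Q : ℕ → Prop := fun n => ∃ S, good S ∧ S.card = n
  have hcard : ∀ S, good S → S.card ≤ 5 ^ Module.finrank ℝ E := fun S hS =>
    Besicovitch.card_le_of_separated S hS.1 hS.2
  have hQ0 : Q 0 := ⟨∅, by simp [good], rfl⟩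
  obtain ⟨S, hS, hSn⟩ : Q (Nat.findGreatest Q (5 ^ Module.finrank ℝ E)) :=
    Nat.findGreatest_spec (Nat.zero_le _) hQ0
  refine ⟨S, hcard S hS, hS.1, fun x => ?_⟩
  -- If `s` is within `1` of `u`, then `⟨s, x⟩ ≥ 2‖x‖ - ‖x‖`. For `x = 0` the convention `2 / 0 = 0`
  -- is harmless.
  set u : E := (2 / ‖x‖) • x with hu
  have hu2 : ‖u‖ ≤ 2 := by
    rw [hu, norm_smul, norm_div, norm_norm, Real.norm_two]
    rcases eq_or_ne ‖x‖ 0 with h | h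
    · simp [h]
    · rw [div_mul_cancel₀ _ h]
  obtain ⟨s, hs, hus⟩ : ∃ s ∈ S, ‖u - s‖ ≤ 1 := by
    by_contra! hcon
    have huS : u ∉ S := fun h => by
      have := hcon u h
      norm_num at this
    have hins : good (insert u S) := by
      refine ⟨fun c hc => ?_, fun c hc d hd hcd => ?_⟩
      · rcases Finset.mem_insert.1 hc with rfl | hc
        exacts [hu2, hS.1 c hc]
      · rcases Finset.mem_insert.1 hc with rfl | hc <;> rcases Finset.mem_insert.1 hd with rfl | hd
        · exact absurd rfl hcd
        · exact (hcon d hd).le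
        · rw [norm_sub_rev]; exact (hcon c hc).le
        · exact hS.2 c hc d hd hcd
    have h1 := hcard _ hins
    have h2 := Nat.le_findGreatest (P := Q) h1 ⟨_, hins, rfl⟩
    rw [← hSn, Finset.card_insert_of_notMem huS] at h2
    omega
  refine ⟨s, hs, ?_⟩
  have h1 : inner ℝ u x = 2 * ‖x‖ := by
    rw [hu, real_inner_smul_left, real_inner_self_eq_norm_sq]
    rcases eq_or_ne ‖x‖ 0 with h | h
    · simp [h]
    · field_simp
  have h2 := real_inner_le_norm (u - s) x
  rw [inner_sub_left, h1] at h2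
  nlinarith [norm_nonneg x]

/-- `S` bounds `‖Z s‖` for `s ∈ T`, and `T` then bounds `‖Zᵀ u‖`; neither passage loses a constant.
-/
lemma bilinear_le_of_norming {N J : ℕ} {S : Finset (EuclideanSpace ℝ (Fin N))}
    {T : Finset (EuclideanSpace ℝ (Fin J))}
    (hS : ∀ x, ∃ s ∈ S, ‖x‖ ≤ inner ℝ s x) (hT : ∀ x, ∃ s ∈ T, ‖x‖ ≤ inner ℝ s x)
    (z : Fin N → Fin J → ℝ) {m : ℝ}
    (hm : ∀ r ∈ S, ∀ s ∈ T, ∑ i, ∑ j, z i j * (r i * s j) ≤ m) :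
    0 ≤ m ∧ ∀ (u : Fin N → ℝ) (v : Fin J → ℝ),
      ∑ i, ∑ j, z i j * (u i * v j) ≤ m * (√(∑ i, u i ^ 2) * √(∑ j, v j ^ 2)) := by
  let Zv : (Fin J → ℝ) → EuclideanSpace ℝ (Fin N) := fun v =>
    WithLp.toLp 2 fun i => ∑ j, z i j * v j
  let uZ : (Fin N → ℝ) → EuclideanSpace ℝ (Fin J) := fun u =>
    WithLp.toLp 2 fun j => ∑ i, z i j * u i
  have e1 : ∀ (u : EuclideanSpace ℝ (Fin N)) (v : EuclideanSpace ℝ (Fin J)),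
      inner ℝ u (Zv v) = ∑ i, ∑ j, z i j * (u i * v j) := by
    intro u v
    simp only [Zv, PiLp.inner_apply, RCLike.inner_apply, conj_trivial, Finset.sum_mul]
    exact Finset.sum_congr rfl fun i _ => Finset.sum_congr rfl fun j _ => by ring
  have e2 : ∀ (u : EuclideanSpace ℝ (Fin N)) (v : EuclideanSpace ℝ (Fin J)),
      inner ℝ v (uZ u) = ∑ i, ∑ j, z i j * (u i * v j) := by
    intro u v
    simp only [uZ, PiLp.inner_apply, RCLike.inner_apply, conj_trivial, Finset.sum_mul]
    rw [Finset.sum_comm]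
    exact Finset.sum_congr rfl fun i _ => Finset.sum_congr rfl fun j _ => by ring
  have hZ : ∀ s ∈ T, ‖Zv s‖ ≤ m := by
    intro s hs
    obtain ⟨r, hr, h⟩ := hS (Zv s)
    exact h.trans (by rw [e1]; exact hm r hr s hs)
  refine ⟨?_, fun u v => ?_⟩
  · obtain ⟨s, hs, -⟩ := hT 0
    exact (norm_nonneg _).trans (hZ s hs)
  · let u' : EuclideanSpace ℝ (Fin N) := WithLp.toLp 2 u
    let v' : EuclideanSpace ℝ (Fin J) := WithLp.toLp 2 v
    have nu : ‖u'‖ = √(∑ i, u i ^ 2) := by simp [u', EuclideanSpace.norm_eq]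
    have nv : ‖v'‖ = √(∑ j, v j ^ 2) := by simp [v', EuclideanSpace.norm_eq]
    rw [← nu, ← nv]
    obtain ⟨s, hs, h⟩ := hT (uZ u')
    have h1 : ‖uZ u'‖ ≤ m * ‖u'‖ := by
      refine h.trans ?_
      rw [e2, ← e1, mul_comm]
      exact (real_inner_le_norm _ _).trans (mul_le_mul_of_nonneg_left (hZ s hs) (norm_nonneg _))
    calc _ = inner ℝ v' (uZ u') := (e2 u' v').symm
      _ ≤ ‖v'‖ * ‖uZ u'‖ := real_inner_le_norm _ _
      _ ≤ ‖v'‖ * (m * ‖u'‖) := by gcongr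
      _ = _ := by ring

/-- The sign `-1` or `1` encoded by an element of `Fin 2`. -/
def signOf (x : Fin 2) : ℝ := 2 * ((x : ℕ) : ℝ) - 1

/-- The average factors into `∏ cosh (c i)`, and `cosh c ≤ exp (c² / 2)`. -/
lemma rademacher_mgf_le {ι : Type*} [Fintype ι] [DecidableEq ι] (c : ι → ℝ) :
    ∑ y : ι → Fin 2, (∏ _i : ι, (1 / 2 : ℝ)) * Real.exp (∑ i, signOf (y i) * c i)
      ≤ Real.exp ((∑ i, c i ^ 2) / 2) := by
  have e : ∑ y : ι → Fin 2, (∏ _i : ι, (1 / 2 : ℝ)) * Real.exp (∑ i, signOf (y i) * c i)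
      = ∏ i, Real.cosh (c i) := by
    have := (Finset.prod_univ_sum (fun _ : ι => (Finset.univ : Finset (Fin 2)))
      (fun i x => (1 / 2 : ℝ) * Real.exp (signOf x * c i)))
    rw [Fintype.piFinset_univ] at this
    simp only [Real.exp_sum, ← Finset.prod_mul_distrib]
    rw [← this]
    refine Finset.prod_congr rfl fun i _ => ?_
    rw [Fin.sum_univ_two, Real.cosh_eq]
    norm_num [signOf]
    ring
  rw [e, Finset.sum_div, Real.exp_sum]
  exact Finset.prod_le_prod (fun i _ => (Real.cosh_pos _).le) fun i _ => Real.cosh_le_exp_half_sq _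

/-! ### Geometry and compactness of the constraint set -/

section Params
variable {N J K : ℕ}

/-- The rows `(1, θ_i)`. -/
def IFAParams.left (ψ : IFAParams N J K) (i : Fin N) : Option (Fin K) → ℝ
  | none => 1
  | some k => ψ.Θ i k

/-- The rows `(d_j, a_j)`. -/
def IFAParams.right (ψ : IFAParams N J K) (j : Fin J) : Option (Fin K) → ℝ
  | none => ψ.d j
  | some k => ψ.A j k

lemma IFAParams.predictor_eq (ψ : IFAParams N J K) (i : Fin N) (j : Fin J) :
    ψ.predictor i j = ∑ k, ψ.left i k * ψ.right j k := by
  simp [IFAParams.predictor, Matrix.mul_apply, Matrix.vecMulVec_apply, left, right, add_comm]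

lemma sum_left_sq_le {C : ℝ} {ψ : IFAParams N J K} (h : ψ ∈ feasibleSet N J K C) (i : Fin N) :
    ∑ k, ψ.left i k ^ 2 ≤ C ^ 2 := by
  have h1 := h.1 i
  rw [EuclideanSpace.norm_sq_eq] at h1
  have h2 : 0 ≤ C := (Real.sqrt_nonneg _).trans h1
  simpa [IFAParams.left] using (Real.sqrt_le_left h2).1 h1

lemma sum_right_sq_le {C : ℝ} {ψ : IFAParams N J K} (h : ψ ∈ feasibleSet N J K C) (j : Fin J) :
    ∑ k, ψ.right j k ^ 2 ≤ C ^ 2 := by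
  have h1 := h.2 j
  rw [EuclideanSpace.norm_sq_eq] at h1
  have h2 : 0 ≤ C := (Real.sqrt_nonneg _).trans h1
  simpa [IFAParams.right] using (Real.sqrt_le_left h2).1 h1

lemma abs_predictor_le {C : ℝ} {ψ : IFAParams N J K} (h : ψ ∈ feasibleSet N J K C)
    (i : Fin N) (j : Fin J) : |ψ.predictor i j| ≤ C ^ 2 := by
  rw [ψ.predictor_eq]
  refine abs_le_of_sq_le_sq ?_ (sq_nonneg C)
  calc _ ≤ (∑ k, ψ.left i k ^ 2) * ∑ k, ψ.right j k ^ 2 := Finset.sum_mul_sq_le_sq_mul_sq _ _ _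
    _ ≤ C ^ 2 * C ^ 2 := mul_le_mul (sum_left_sq_le h i) (sum_right_sq_le h j)
        (Finset.sum_nonneg fun _ _ => sq_nonneg _) (sq_nonneg _)
    _ = _ := by ring

/-- The predictor is a sum of rank-one matrices, one per column of the factors. Cauchy-Schwarz over
the columns leaves only the factors' Frobenius norms, at most `C√N` and `C√J`, so `K` disappears. -/
lemma abs_sum_mul_predictor_le {C : ℝ} {ψ : IFAParams N J K}
    (h : ψ ∈ feasibleSet N J K C) (z : Fin N → Fin J → ℝ) {m : ℝ} (hm0 : 0 ≤ m)
    (hm : ∀ (u : Fin N → ℝ) (v : Fin J → ℝ),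
      ∑ i, ∑ j, z i j * (u i * v j) ≤ m * (√(∑ i, u i ^ 2) * √(∑ j, v j ^ 2))) :
    |∑ i, ∑ j, z i j * ψ.predictor i j| ≤ m * (C ^ 2 * √((N : ℝ) * J)) := by
  have e : ∑ i, ∑ j, z i j * ψ.predictor i j
      = ∑ k, ∑ i, ∑ j, z i j * (ψ.left i k * ψ.right j k) := by
    simp only [ψ.predictor_eq, Finset.mul_sum]
    rw [Finset.sum_comm (s := (Finset.univ : Finset (Option (Fin K))))]
    exact Finset.sum_congr rfl fun i _ => Finset.sum_comm
  have hm' : ∀ (u : Fin N → ℝ) (v : Fin J → ℝ),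
      |∑ i, ∑ j, z i j * (u i * v j)| ≤ m * (√(∑ i, u i ^ 2) * √(∑ j, v j ^ 2)) := by
    intro u v
    refine abs_le'.2 ⟨hm u v, ?_⟩
    simpa using hm (fun i => - u i) v
  have hl : ∑ k, ∑ i, ψ.left i k ^ 2 ≤ N * C ^ 2 := by
    rw [Finset.sum_comm]
    simpa using Finset.sum_le_card_nsmul Finset.univ _ _ fun i _ => sum_left_sq_le h i
  have hr : ∑ k, ∑ j, ψ.right j k ^ 2 ≤ J * C ^ 2 := by
    rw [Finset.sum_comm]
    simpa using Finset.sum_le_card_nsmul Finset.univ _ _ fun i _ => sum_right_sq_le h i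
  rw [e]
  calc _ ≤ ∑ k, |∑ i, ∑ j, z i j * (ψ.left i k * ψ.right j k)| := Finset.abs_sum_le_sum_abs _ _
    _ ≤ ∑ k, m * (√(∑ i, ψ.left i k ^ 2) * √(∑ j, ψ.right j k ^ 2)) :=
        Finset.sum_le_sum fun k _ => hm' (fun i => ψ.left i k) (fun j => ψ.right j k)
    _ = m * ∑ k, √(∑ i, ψ.left i k ^ 2) * √(∑ j, ψ.right j k ^ 2) := by rw [Finset.mul_sum]
    _ ≤ m * (√(∑ k, ∑ i, ψ.left i k ^ 2) * √(∑ k, ∑ j, ψ.right j k ^ 2)) := by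
        gcongr
        refine (Real.sum_mul_le_sqrt_mul_sqrt _ _ _).trans_eq ?_
        congr 2 <;> refine Finset.sum_congr rfl fun k _ => Real.sq_sqrt ?_ <;> positivity
    _ ≤ m * (√(N * C ^ 2) * √(J * C ^ 2)) := by gcongr
    _ = _ := by
        rw [← Real.sqrt_mul (by positivity)]
        rw [show (N : ℝ) * C ^ 2 * (J * C ^ 2) = (C ^ 2) ^ 2 * (N * J) by ring,
          Real.sqrt_mul (by positivity), Real.sqrt_sq (sq_nonneg C)]

lemma isCJMLE_exists {C : ℝ} {f : ℝ → ℝ} (hf : LinkRegular f C)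
    (hne : (feasibleSet N J K C).Nonempty) (y : Fin N → Fin J → Fin 2) :
    ∃ ψ : IFAParams N J K, IsCJMLE f C y ψ := by
  -- Compactness is used in this product space, since `IFAParams` carries no topology.
  let Φ : (Fin N → Fin K → ℝ) × (Fin J → Fin K → ℝ) × (Fin J → ℝ) → IFAParams N J K :=
    fun q => ⟨q.1, q.2.1, q.2.2⟩
  have hfc : Continuous f := hf.differentiable.continuous
  have hpred : ∀ i j, Continuous fun q => (Φ q).predictor i j := by
    intro i j
    simp only [IFAParams.predictor_eq, Fintype.sum_option]
    change Continuous fun q : (Fin N → Fin K → ℝ) × (Fin J → Fin K → ℝ) × (Fin J → ℝ) =>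
      1 * q.2.2 j + ∑ k, q.1 i k * q.2.1 j k
    fun_prop
  have hset : Φ ⁻¹' feasibleSet N J K C =
      (⋂ i, {q | √(1 + ∑ k, q.1 i k ^ 2) ≤ C}) ∩
        ⋂ j, {q | √(q.2.2 j ^ 2 + ∑ k, q.2.1 j k ^ 2) ≤ C} := by
    ext q
    simp [feasibleSet, EuclideanSpace.norm_sq_eq, Φ]
  have hcl : IsClosed (Φ ⁻¹' feasibleSet N J K C) := by
    rw [hset]
    exact (isClosed_iInter fun i => isClosed_le (by fun_prop) continuous_const).inter
      (isClosed_iInter fun j => isClosed_le (by fun_prop) continuous_const)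
  have hentry : ∀ x c : ℝ, ∀ s : ℝ, x ^ 2 ≤ s → √s ≤ c → -c ≤ x ∧ x ≤ c := fun x c s h1 h2 =>
    abs_le.1 ((Real.abs_le_sqrt h1).trans h2)
  have hsub : Φ ⁻¹' feasibleSet N J K C ⊆ Set.Icc
      ((fun _ _ => -C), (fun _ _ => -C), fun _ => -C) ((fun _ _ => C), (fun _ _ => C), fun _ => C) := by
    rw [hset]
    rintro ⟨θ, a, d⟩ ⟨h1, h2⟩
    simp only [Set.mem_iInter, Set.mem_ofPred_eq] at h1 h2
    have t1 : ∀ i k, -C ≤ θ i k ∧ θ i k ≤ C := fun i k => hentry _ _ _ (by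
      have := Finset.single_le_sum (f := fun k => θ i k ^ 2) (fun _ _ => sq_nonneg _)
        (Finset.mem_univ k)
      linarith) (h1 i)
    have t2 : ∀ j k, -C ≤ a j k ∧ a j k ≤ C := fun j k => hentry _ _ _ (by
      have := Finset.single_le_sum (f := fun k => a j k ^ 2) (fun _ _ => sq_nonneg _)
        (Finset.mem_univ k)
      linarith [sq_nonneg (d j)]) (h2 j)
    have t3 : ∀ j, -C ≤ d j ∧ d j ≤ C := fun j => hentry _ _ _ (by
      have := Finset.sum_nonneg (s := Finset.univ) (f := fun k => a j k ^ 2)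
        (fun _ _ => sq_nonneg _)
      linarith) (h2 j)
    exact ⟨⟨fun i k => (t1 i k).1, fun i k => (t2 i k).1, fun j => (t3 j).1⟩,
      ⟨fun i k => (t1 i k).2, fun i k => (t2 i k).2, fun j => (t3 j).2⟩⟩
  have hcomp := isCompact_Icc.of_isClosed_subset hcl hsub
  obtain ⟨ψ₀, h₀⟩ := hne
  have hcont : ContinuousOn (fun q => Real.log (jointLik f y (Φ q))) (Φ ⁻¹' feasibleSet N J K C) := by
    refine ContinuousOn.log (Continuous.continuousOn ?_) fun q hq => ?_
    · unfold jointLik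
      fun_prop
    · refine (Finset.prod_pos fun i _ => Finset.prod_pos fun j _ => ?_).ne'
      have := abs_predictor_le hq i j
      exact mul_pos (pow_pos (hf.pos _ this) _) (pow_pos (sub_pos.2 (hf.lt_one _ this)) _)
  obtain ⟨q, hq, hmax⟩ := hcomp.exists_isMaxOn ⟨(ψ₀.Θ, ψ₀.A, ψ₀.d), h₀⟩ hcont
  exact ⟨Φ q, hq, isMaxOn_iff.2 fun ψ hψ => isMaxOn_iff.1 hmax (ψ.Θ, ψ.A, ψ.d) hψ⟩

end Params

/-! ### Log-likelihood and the basic inequality -/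

section Likelihood
variable {N J K : ℕ}

lemma log_jointLik {f : ℝ → ℝ} {C : ℝ} (hf : LinkRegular f C) (y : Fin N → Fin J → Fin 2)
    {ψ : IFAParams N J K} (hψ : ψ ∈ feasibleSet N J K C) :
    Real.log (jointLik f y ψ) = ∑ i, ∑ j, (((y i j : ℕ) : ℝ) * logOdds f (ψ.predictor i j)
      + Real.log (1 - f (ψ.predictor i j))) := by
  have hpos : ∀ i j, 0 < f (ψ.predictor i j) := fun i j => hf.pos _ (abs_predictor_le hψ i j)
  have hlt : ∀ i j, 0 < 1 - f (ψ.predictor i j) := fun i j =>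
    sub_pos.2 (hf.lt_one _ (abs_predictor_le hψ i j))
  have hterm : ∀ i j, 0 < f (ψ.predictor i j) ^ (y i j : ℕ) *
      (1 - f (ψ.predictor i j)) ^ (1 - (y i j : ℕ)) := fun i j =>
    mul_pos (pow_pos (hpos i j) _) (pow_pos (hlt i j) _)
  rw [jointLik, Real.log_prod fun i _ => (Finset.prod_pos fun j _ => hterm i j).ne']
  refine Finset.sum_congr rfl fun i _ => ?_
  rw [Real.log_prod fun j _ => (hterm i j).ne']
  refine Finset.sum_congr rfl fun j _ => ?_
  generalize y i j = x
  fin_cases x <;> simp [logOdds]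

/-- The basic inequality of maximum likelihood: the divergence of the fitted from the true model is
at most the fluctuation of the log-likelihood ratio. -/
lemma IsCJMLE.sum_bernoulliKL_le {f : ℝ → ℝ} {C : ℝ} (hf : LinkRegular f C)
    {y : Fin N → Fin J → Fin 2} {ψ ψ' : IFAParams N J K} (hψ : IsCJMLE f C y ψ)
    (hψ' : ψ' ∈ feasibleSet N J K C) :
    ∑ i, ∑ j, bernoulliKL (f (ψ'.predictor i j)) (f (ψ.predictor i j))
      ≤ ∑ i, ∑ j, (((y i j : ℕ) : ℝ) - f (ψ'.predictor i j)) *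
        (logOdds f (ψ.predictor i j) - logOdds f (ψ'.predictor i j)) := by
  have h := isMaxOn_iff.1 hψ.2 ψ' hψ'
  rw [log_jointLik hf y hψ', log_jointLik hf y hψ.1] at h
  rw [← sub_nonneg] at h ⊢
  refine h.trans_eq ?_
  simp only [← Finset.sum_sub_distrib]
  refine Finset.sum_congr rfl fun i _ => Finset.sum_congr rfl fun j _ => ?_
  unfold logOdds bernoulliKL
  ring

end Likelihood

/-! ### Uniform tail bound for the fluctuation -/

section Tail
variable {N J K : ℕ}

lemma rademacher_exp_iSup_predictor_le {α : Type*} [Finite α] [Nonempty α] {C : ℝ}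
    {ψ : α → IFAParams N J K} (hψ : ∀ t, ψ t ∈ feasibleSet N J K C)
    {ψ' : IFAParams N J K} (hψ' : ψ' ∈ feasibleSet N J K C) {R : ℝ} (hR : 0 ≤ R) :
    ∑ y : Fin N × Fin J → Fin 2, (∏ _p : Fin N × Fin J, (1 / 2 : ℝ)) *
        Real.exp (⨆ t, ∑ p, signOf (y p) *
          (R * ((ψ t).predictor p.1 p.2 - ψ'.predictor p.1 p.2)))
      ≤ 5 ^ (N + J) * Real.exp (8 * (2 * R * C ^ 2 * √((N : ℝ) * J)) ^ 2) := by
  obtain ⟨S, hSc, hS2, hS⟩ := exists_norming_finset (EuclideanSpace ℝ (Fin N))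
  obtain ⟨T, hTc, hT2, hT⟩ := exists_norming_finset (EuclideanSpace ℝ (Fin J))
  rw [finrank_euclideanSpace_fin] at hSc hTc
  set ρ : ℝ := 2 * R * C ^ 2 * √((N : ℝ) * J) with hρ
  have hne : (S ×ˢ T).Nonempty := by
    obtain ⟨s, hs, -⟩ := hS 0
    obtain ⟨t, ht, -⟩ := hT 0
    exact ⟨(s, t), Finset.mk_mem_product hs ht⟩
  -- The best pair of norming vectors for `y` bounds the supremum; summing over all pairs removes
  -- the dependence on `y`. The `2` in `ρ` accounts for the two predictors.
  have hpt : ∀ y : Fin N × Fin J → Fin 2,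
      Real.exp (⨆ t, ∑ p, signOf (y p) *
          (R * ((ψ t).predictor p.1 p.2 - ψ'.predictor p.1 p.2)))
        ≤ ∑ q ∈ S ×ˢ T, Real.exp (∑ p : Fin N × Fin J,
            signOf (y p) * (ρ * (q.1 p.1 * q.2 p.2))) := by
    intro y
    let z : Fin N → Fin J → ℝ := fun i j => signOf (y (i, j))
    obtain ⟨q, hq, hmax⟩ := Finset.exists_max_image (S ×ˢ T)
      (fun q => ∑ i, ∑ j, z i j * (q.1 i * q.2 j)) hne
    obtain ⟨hm0, hm⟩ := bilinear_le_of_norming hS hT z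
      (fun r hr s hs => hmax (r, s) (Finset.mk_mem_product hr hs))
    refine le_trans (Real.exp_le_exp.2 (ciSup_le fun t => ?_))
      (Finset.single_le_sum (f := fun q : EuclideanSpace ℝ (Fin N) × EuclideanSpace ℝ (Fin J) =>
        Real.exp (∑ p : Fin N × Fin J, signOf (y p) * (ρ * (q.1 p.1 * q.2 p.2))))
        (fun _ _ => (Real.exp_pos _).le) hq)
    have h1 := le_of_abs_le (abs_sum_mul_predictor_le (hψ t) z hm0 hm)
    have h2 := neg_le_of_abs_le (abs_sum_mul_predictor_le hψ' z hm0 hm)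
    have e1 : ∑ p : Fin N × Fin J, signOf (y p) *
          (R * ((ψ t).predictor p.1 p.2 - ψ'.predictor p.1 p.2))
        = R * (∑ i, ∑ j, z i j * (ψ t).predictor i j - ∑ i, ∑ j, z i j * ψ'.predictor i j) := by
      simp only [Fintype.sum_prod_type, ← Finset.sum_sub_distrib, Finset.mul_sum]
      exact Finset.sum_congr rfl fun i _ => Finset.sum_congr rfl fun j _ => by simp only [z]; ring
    have e2 : ∑ p : Fin N × Fin J, signOf (y p) * (ρ * (q.1 p.1 * q.2 p.2))
        = ρ * ∑ i, ∑ j, z i j * (q.1 i * q.2 j) := by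
      simp only [Fintype.sum_prod_type, Finset.mul_sum]
      exact Finset.sum_congr rfl fun i _ => Finset.sum_congr rfl fun j _ => by simp only [z]; ring
    rw [e1, e2]
    refine (mul_le_mul_of_nonneg_left (sub_le_sub h1 h2) hR).trans_eq ?_
    rw [hρ]; ring
  have hsq : ∀ (n : ℕ) (s : EuclideanSpace ℝ (Fin n)), ‖s‖ ≤ 2 → ∑ i, s i ^ 2 ≤ 4 := by
    intro n s hs
    have := EuclideanSpace.norm_sq_eq s
    simp only [Real.norm_eq_abs, sq_abs] at this
    rw [← this]
    nlinarith [norm_nonneg s]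
  have hmgf : ∀ q ∈ S ×ˢ T, ∑ y : Fin N × Fin J → Fin 2, (∏ _p : Fin N × Fin J, (1 / 2 : ℝ)) *
      Real.exp (∑ p : Fin N × Fin J, signOf (y p) * (ρ * (q.1 p.1 * q.2 p.2)))
        ≤ Real.exp (8 * ρ ^ 2) := by
    intro q hq
    rw [Finset.mem_product] at hq
    refine (rademacher_mgf_le _).trans (Real.exp_le_exp.2 ?_)
    have e : ∑ p : Fin N × Fin J, (ρ * (q.1 p.1 * q.2 p.2)) ^ 2
        = ρ ^ 2 * ((∑ i, q.1 i ^ 2) * ∑ j, q.2 j ^ 2) := by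
      rw [Fintype.sum_mul_sum, Fintype.sum_prod_type, Finset.mul_sum]
      simp only [Finset.mul_sum, mul_pow]
    have h : (∑ i, q.1 i ^ 2) * ∑ j, q.2 j ^ 2 ≤ 4 * 4 :=
      mul_le_mul (hsq _ _ (hS2 _ hq.1)) (hsq _ _ (hT2 _ hq.2))
        (Finset.sum_nonneg fun _ _ => sq_nonneg _) (by norm_num)
    rw [e]
    nlinarith [mul_le_mul_of_nonneg_left h (sq_nonneg ρ)]
  calc _ ≤ ∑ y : Fin N × Fin J → Fin 2, (∏ _p : Fin N × Fin J, (1 / 2 : ℝ)) *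
        ∑ q ∈ S ×ˢ T, Real.exp (∑ p : Fin N × Fin J,
            signOf (y p) * (ρ * (q.1 p.1 * q.2 p.2))) :=
        Finset.sum_le_sum fun y _ => mul_le_mul_of_nonneg_left (hpt y)
          (Finset.prod_nonneg fun _ _ => by norm_num)
    _ = ∑ q ∈ S ×ˢ T, ∑ y : Fin N × Fin J → Fin 2, (∏ _p : Fin N × Fin J, (1 / 2 : ℝ)) *
        Real.exp (∑ p : Fin N × Fin J, signOf (y p) * (ρ * (q.1 p.1 * q.2 p.2))) := by
        simp only [Finset.mul_sum]
        rw [Finset.sum_comm]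
    _ ≤ (S ×ˢ T).card • Real.exp (8 * ρ ^ 2) := Finset.sum_le_card_nsmul _ _ _ hmgf
    _ ≤ _ := by
        rw [nsmul_eq_mul, Finset.card_product, pow_add]
        push_cast
        gcongr
        · exact_mod_cast hSc
        · exact_mod_cast hTc

/-- The weights of the Bernoulli distribution on `Fin 2`. -/
def bernoulliWeight (p : ℝ) (x : Fin 2) : ℝ := if x = 1 then p else 1 - p

lemma bernoulli_exp_iSup_le_rademacher {α : Type*} [Finite α] [Nonempty α] {p : ℝ} (hp : 0 ≤ p)
    (hp1 : p ≤ 1) (g b : α → ℝ) (h0 : ∀ t, |g t| ≤ |b t|)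
    (h1 : ∀ s t, |g s - g t| ≤ |b s - b t|) (a : α → ℝ) :
    ∑ x : Fin 2, bernoulliWeight p x * Real.exp (⨆ t, a t + (((x : ℕ) : ℝ) - p) * g t)
      ≤ ∑ x : Fin 2, 1 / 2 * Real.exp (⨆ t, a t + signOf x * b t) := by
  have k1 := exp_iSup_bernoulli_le_rademacher a g hp hp1
  have k2 := exp_iSup_contraction a g b h0 h1
  have e0 : signOf 0 = -1 := by norm_num [signOf]
  have e1 : signOf 1 = 1 := by norm_num [signOf]
  simp only [Fin.sum_univ_two, e0, e1, neg_one_mul, one_mul, ← sub_eq_add_neg]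
  simp only [bernoulliWeight, Fin.isValue, zero_ne_one, if_false, if_true, Fin.val_zero,
    Fin.val_one, Nat.cast_zero, Nat.cast_one]
  linarith

/-- A tail bound, uniform over the constraint set, for the fluctuation of the log-likelihood
ratio. -/
lemma sum_weight_le_of_large_fluctuation {f : ℝ → ℝ} {C L : ℝ} (hf : LinkRegular f C) (hL : 0 < L)
    (hlip : ∀ x y, |x| ≤ C ^ 2 → |y| ≤ C ^ 2 → |logOdds f x - logOdds f y| ≤ L * |x - y|)
    {ψ' : IFAParams N J K} (hψ' : ψ' ∈ feasibleSet N J K C)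
    (B : Finset (Fin N × Fin J → Fin 2)) {τ l : ℝ} (hl : 0 ≤ l)
    (hB : ∀ y ∈ B, ∃ ψ ∈ feasibleSet N J K C,
      τ ≤ ∑ p : Fin N × Fin J, (((y p : ℕ) : ℝ) - f (ψ'.predictor p.1 p.2)) *
        (logOdds f (ψ.predictor p.1 p.2) - logOdds f (ψ'.predictor p.1 p.2))) :
    ∑ y ∈ B, ∏ p, bernoulliWeight (f (ψ'.predictor p.1 p.2)) (y p)
      ≤ Real.exp (-(l * τ)) *
        (5 ^ (N + J) * Real.exp (8 * (2 * (l * L) * C ^ 2 * √((N : ℝ) * J)) ^ 2)) := by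
  -- One witness is chosen per response array, so the suprema run over a finite index set; outside
  -- `B` any feasible point serves.
  have hB' : ∀ y : Fin N × Fin J → Fin 2, ∃ ψ ∈ feasibleSet N J K C, y ∈ B →
      τ ≤ ∑ p : Fin N × Fin J, (((y p : ℕ) : ℝ) - f (ψ'.predictor p.1 p.2)) *
        (logOdds f (ψ.predictor p.1 p.2) - logOdds f (ψ'.predictor p.1 p.2)) := by
    intro y
    by_cases hy : y ∈ B
    · obtain ⟨ψ, h1, h2⟩ := hB y hy
      exact ⟨ψ, h1, fun _ => h2⟩
    · exact ⟨ψ', hψ', fun h => absurd h hy⟩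
  choose ψ hψ hτ using hB'
  have hf0 : ∀ p : Fin N × Fin J, 0 ≤ f (ψ'.predictor p.1 p.2) := fun p =>
    (hf.pos _ (abs_predictor_le hψ' _ _)).le
  have hf1 : ∀ p : Fin N × Fin J, f (ψ'.predictor p.1 p.2) ≤ 1 := fun p =>
    (hf.lt_one _ (abs_predictor_le hψ' _ _)).le
  have hw : ∀ (p : Fin N × Fin J) x, 0 ≤ bernoulliWeight (f (ψ'.predictor p.1 p.2)) x := by
    intro p x
    unfold bernoulliWeight
    split_ifs
    exacts [hf0 p, sub_nonneg.2 (hf1 p)]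
  let g : Fin N × Fin J → (Fin N × Fin J → Fin 2) → ℝ := fun p t =>
    l * (logOdds f ((ψ t).predictor p.1 p.2) - logOdds f (ψ'.predictor p.1 p.2))
  let b : Fin N × Fin J → (Fin N × Fin J → Fin 2) → ℝ := fun p t =>
    l * L * ((ψ t).predictor p.1 p.2 - ψ'.predictor p.1 p.2)
  have hg0 : ∀ p t, |g p t| ≤ |b p t| := by
    intro p t
    simp only [g, b, abs_mul, abs_of_nonneg hl, abs_of_pos hL, mul_assoc]
    exact mul_le_mul_of_nonneg_left
      (hlip _ _ (abs_predictor_le (hψ t) _ _) (abs_predictor_le hψ' _ _)) hl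
  have hg1 : ∀ p s t, |g p s - g p t| ≤ |b p s - b p t| := by
    intro p s t
    simp only [g, b, ← mul_sub, sub_sub_sub_cancel_right, abs_mul, abs_of_nonneg hl,
      abs_of_pos hL, mul_assoc]
    exact mul_le_mul_of_nonneg_left
      (hlip _ _ (abs_predictor_le (hψ s) _ _) (abs_predictor_le (hψ t) _ _)) hl
  calc ∑ y ∈ B, ∏ p, bernoulliWeight (f (ψ'.predictor p.1 p.2)) (y p)
      ≤ ∑ y ∈ B, Real.exp (-(l * τ)) * ((∏ p, bernoulliWeight (f (ψ'.predictor p.1 p.2)) (y p)) *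
          Real.exp (⨆ t, ∑ p, (((y p : ℕ) : ℝ) - f (ψ'.predictor p.1 p.2)) * g p t)) := by
        refine Finset.sum_le_sum fun y hy => ?_
        rw [mul_left_comm, ← Real.exp_add]
        refine le_mul_of_one_le_right (Finset.prod_nonneg fun p _ => hw p _) (Real.one_le_exp ?_)
        have h1 := le_ciSup_finite
          (fun t => ∑ p, (((y p : ℕ) : ℝ) - f (ψ'.predictor p.1 p.2)) * g p t) y
        have h2 := mul_le_mul_of_nonneg_left (hτ y hy) hl
        have e : ∑ p, (((y p : ℕ) : ℝ) - f (ψ'.predictor p.1 p.2)) * g p y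
            = l * ∑ p : Fin N × Fin J, (((y p : ℕ) : ℝ) - f (ψ'.predictor p.1 p.2)) *
              (logOdds f ((ψ y).predictor p.1 p.2) - logOdds f (ψ'.predictor p.1 p.2)) := by
          rw [Finset.mul_sum]
          exact Finset.sum_congr rfl fun p _ => by simp only [g]; ring
        linarith
    _ ≤ ∑ y : Fin N × Fin J → Fin 2, Real.exp (-(l * τ)) *
        ((∏ p, bernoulliWeight (f (ψ'.predictor p.1 p.2)) (y p)) *
          Real.exp (⨆ t, ∑ p, (((y p : ℕ) : ℝ) - f (ψ'.predictor p.1 p.2)) * g p t)) :=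
        Finset.sum_le_sum_of_subset_of_nonneg (Finset.subset_univ B) fun y _ _ =>
          mul_nonneg (Real.exp_pos _).le (mul_nonneg (Finset.prod_nonneg fun p _ => hw p _)
            (Real.exp_pos _).le)
    _ = Real.exp (-(l * τ)) * ∑ y : Fin N × Fin J → Fin 2,
          (∏ p, bernoulliWeight (f (ψ'.predictor p.1 p.2)) (y p)) *
          Real.exp (⨆ t, ∑ p, (((y p : ℕ) : ℝ) - f (ψ'.predictor p.1 p.2)) * g p t) := by
        rw [Finset.mul_sum]
    _ ≤ Real.exp (-(l * τ)) * ∑ y : Fin N × Fin J → Fin 2,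
          (∏ _p : Fin N × Fin J, (1 / 2 : ℝ)) * Real.exp (⨆ t, ∑ p, signOf (y p) * b p t) := by
        refine mul_le_mul_of_nonneg_left ?_ (Real.exp_pos _).le
        exact sum_prod_mul_exp_iSup_le
          (fun p => bernoulliWeight (f (ψ'.predictor p.1 p.2))) (fun _ _ => 1 / 2) hw
          (fun _ _ => by norm_num)
          (fun p x t => (((x : ℕ) : ℝ) - f (ψ'.predictor p.1 p.2)) * g p t)
          (fun p x t => signOf x * b p t)
          fun p a => bernoulli_exp_iSup_le_rademacher (hf0 p) (hf1 p) _ _ (hg0 p) (hg1 p) a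
    _ ≤ _ := mul_le_mul_of_nonneg_left
        (rademacher_exp_iSup_predictor_le hψ hψ' (mul_nonneg hl hL.le)) (Real.exp_pos _).le

lemma exists_exponent_tail_le_one_div {n M D : ℝ} (hn : 0 < n) (hM : 0 < M) (hD : 0 < D)
    {k : ℕ} (hk : (k : ℝ) = n) :
    ∃ l : ℝ, 0 ≤ l ∧ Real.exp (-(l * (32 * D * (√M * √n)))) *
      (5 ^ k * Real.exp (8 * (2 * l * D * √M) ^ 2)) ≤ 1 / n := by
  have hM' := Real.sqrt_pos.2 hM
  -- The exponents become `-4n`, at most `2n` (from `5 ≤ e²`) and `n / 2`, in total at most `-3n /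
  -- 2`; this `l` is not optimal.
  refine ⟨√n / (8 * D * √M), by positivity, ?_⟩
  have e1 : √n / (8 * D * √M) * (32 * D * (√M * √n)) = 4 * n := by
    nth_rewrite 3 [← Real.mul_self_sqrt hn.le]
    field_simp
    norm_num
  have e2 : 8 * (2 * (√n / (8 * D * √M)) * D * √M) ^ 2 = n / 2 := by
    have : 2 * (√n / (8 * D * √M)) * D * √M = √n / 4 := by field_simp; norm_num
    rw [this, div_pow, Real.sq_sqrt hn.le]; ring
  have h5 : (5 : ℝ) ^ k ≤ Real.exp (2 * n) := by
    have : (5 : ℝ) ≤ Real.exp 2 := by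
      have h := Real.exp_one_gt_d9
      have : Real.exp 2 = Real.exp 1 * Real.exp 1 := by rw [← Real.exp_add]; norm_num
      nlinarith
    calc (5 : ℝ) ^ k ≤ Real.exp 2 ^ k := by gcongr
      _ = _ := by rw [← Real.exp_nat_mul, hk, mul_comm]
  rw [e1, e2]
  calc _ ≤ Real.exp (-(4 * n)) * (Real.exp (2 * n) * Real.exp (n / 2)) := by gcongr
    _ = Real.exp (-(3 / 2 * n)) := by rw [← Real.exp_add, ← Real.exp_add]; ring_nf
    _ ≤ (Real.exp n)⁻¹ := by rw [← Real.exp_neg]; exact Real.exp_le_exp.2 (by linarith)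
    _ ≤ 1 / n := by
      rw [← one_div]
      exact one_div_le_one_div_of_le hn (by linarith [Real.add_one_le_exp n])

end Tail

/-! ### Law of the responses and conclusion -/

lemma IsIFAModel.measureReal_eq_prod {N J K : ℕ} {Ω : Type*} [MeasurableSpace Ω]
    {P : MeasureTheory.Measure Ω} [MeasureTheory.IsProbabilityMeasure P] {f : ℝ → ℝ}
    {ψ : IFAParams N J K} {Y : Fin N → Fin J → Ω → Fin 2} (h : IsIFAModel P f ψ Y)
    (y : Fin N × Fin J → Fin 2) :
    P.real {ω | ∀ p : Fin N × Fin J, Y p.1 p.2 ω = y p}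
      = ∏ p, bernoulliWeight (f (ψ.predictor p.1 p.2)) (y p) := by
  have h1 := h.indep.measure_inter_preimage_eq_mul Finset.univ (sets := fun p => {y p})
    fun p _ => measurableSet_singleton _
  have e : {ω | ∀ p : Fin N × Fin J, Y p.1 p.2 ω = y p}
      = ⋂ p ∈ (Finset.univ : Finset (Fin N × Fin J)), Y p.1 p.2 ⁻¹' {y p} := by
    ext ω; simp
  rw [MeasureTheory.measureReal_def, e, h1, ENNReal.toReal_prod]
  refine Finset.prod_congr rfl fun p _ => ?_
  rw [← MeasureTheory.measureReal_def, bernoulliWeight, ← h.prob_one]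
  have hm : MeasurableSet {ω | Y p.1 p.2 ω = 1} :=
    h.measurable p.1 p.2 (measurableSet_singleton 1)
  split_ifs with hy
  · rw [hy]; rfl
  · rw [← MeasureTheory.probReal_compl_eq_one_sub hm]
    congr 1
    ext ω
    simp only [Set.mem_preimage, Set.mem_singleton_iff, Set.mem_compl_iff, Set.mem_ofPred_eq]
    omega

theorem theorem1 (C : ℝ) (hC : 0 < C) (f : ℝ → ℝ) (hf : LinkRegular f C) :
    ∃ C₁ C₂ : ℝ, 0 < C₁ ∧ 0 < C₂ ∧
      ∀ (K N J : ℕ), 1 ≤ N → 1 ≤ J →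
      ∀ (ψstar : IFAParams N J K), ψstar ∈ feasibleSet N J K C →
      ∀ (Ω : Type*) [MeasurableSpace Ω] (P : MeasureTheory.Measure Ω)
        [MeasureTheory.IsProbabilityMeasure P] (Y : Fin N → Fin J → Ω → Fin 2),
        IsIFAModel P f ψstar Y →
        (∀ y : Fin N → Fin J → Fin 2, ∃ ψ : IFAParams N J K, IsCJMLE f C y ψ) ∧
        1 - C₁ / ((N : ℝ) + J) ≤
          P.real {ω | ∀ ψhat : IFAParams N J K, IsCJMLE f C (fun i j => Y i j ω) ψhat →
            1 / ((N : ℝ) * J) * frobNorm (ψhat.predictor - ψstar.predictor) ^ 2 ≤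
              C₂ * √(((J : ℝ) + N) / ((N : ℝ) * J))} := by
  classical
  obtain ⟨L, hL, hlip⟩ := hf.exists_logOdds_lipschitz
  obtain ⟨c, hc, hkl⟩ := hf.exists_sq_sub_le_bernoulliKL
  refine ⟨1, 32 * (L * C ^ 2) / c, one_pos, by positivity, ?_⟩
  intro K N J hN hJ ψs hψs Ω _ P _ Y hY
  refine ⟨isCJMLE_exists hf ⟨ψs, hψs⟩, ?_⟩
  have hN' : (0 : ℝ) < N := by exact_mod_cast hN
  have hJ' : (0 : ℝ) < J := by exact_mod_cast hJ
  have hM : (0 : ℝ) < N * J := by positivity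
  have hn : (0 : ℝ) < N + J := by positivity
  set G := {ω | ∀ ψhat : IFAParams N J K, IsCJMLE f C (fun i j => Y i j ω) ψhat →
            1 / ((N : ℝ) * J) * frobNorm (ψhat.predictor - ψs.predictor) ^ 2 ≤
              32 * (L * C ^ 2) / c * √(((J : ℝ) + N) / ((N : ℝ) * J))} with hG
  -- This is `c * NJ` times the claimed error bound, so a larger error forces a fluctuation of at
  -- least `τ`.
  set τ : ℝ := 32 * (L * C ^ 2) * (√((N : ℝ) * J) * √((N : ℝ) + J)) with hτ
  let B : Finset (Fin N × Fin J → Fin 2) := {y | ∃ ψ ∈ feasibleSet N J K C,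
      τ ≤ ∑ p : Fin N × Fin J, (((y p : ℕ) : ℝ) - f (ψs.predictor p.1 p.2)) *
        (logOdds f (ψ.predictor p.1 p.2) - logOdds f (ψs.predictor p.1 p.2))}
  have hsub : Gᶜ ⊆ ⋃ y ∈ B, {ω | ∀ p : Fin N × Fin J, Y p.1 p.2 ω = y p} := by
    intro ω hω
    simp only [hG, Set.mem_compl_iff, Set.mem_ofPred_eq, not_forall, not_le] at hω
    obtain ⟨ψ, hψ, hlt⟩ := hω
    simp only [Set.mem_iUnion, Set.mem_ofPred_eq]
    refine ⟨fun p => Y p.1 p.2 ω, ?_, fun _ => rfl⟩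
    simp only [B, Finset.mem_filter, Finset.mem_univ, true_and]
    refine ⟨ψ, hψ.1, ?_⟩
    rw [Fintype.sum_prod_type]
    refine le_trans ?_ (hψ.sum_bernoulliKL_le hf hψs)
    have h1 : c * frobNorm (ψ.predictor - ψs.predictor) ^ 2
        ≤ ∑ i, ∑ j, bernoulliKL (f (ψs.predictor i j)) (f (ψ.predictor i j)) := by
      rw [frobNorm, Real.sq_sqrt (by positivity)]
      simp only [Finset.mul_sum]
      exact Finset.sum_le_sum fun i _ => Finset.sum_le_sum fun j _ =>
        hkl _ _ (abs_predictor_le hψ.1 i j) (abs_predictor_le hψs i j)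
    refine le_trans ?_ h1
    have h2 : √(((J : ℝ) + N) / ((N : ℝ) * J)) * ((N : ℝ) * J)
        = √((N : ℝ) * J) * √((N : ℝ) + J) := by
      rw [Real.sqrt_div (by positivity), add_comm (J : ℝ)]
      nth_rewrite 2 [← Real.mul_self_sqrt hM.le]
      have := Real.sqrt_pos.2 hM
      field_simp
    rw [one_div, inv_mul_eq_div, lt_div_iff₀ hM, mul_assoc, h2, div_mul_eq_mul_div,
      div_lt_iff₀ hc] at hlt
    rw [hτ]
    linarith
  obtain ⟨l, hl, hbound⟩ := exists_exponent_tail_le_one_div hn hM (show 0 < L * C ^ 2 by positivity)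
    (k := N + J) (by push_cast; rfl)
  have htail := sum_weight_le_of_large_fluctuation hf hL hlip hψs B hl
    (τ := τ) (fun y hy => (Finset.mem_filter.1 hy).2)
  have hcompl : P.real Gᶜ ≤ 1 / ((N : ℝ) + J) := by
    calc P.real Gᶜ ≤ P.real (⋃ y ∈ B, {ω | ∀ p : Fin N × Fin J, Y p.1 p.2 ω = y p}) :=
          MeasureTheory.measureReal_mono hsub (MeasureTheory.measure_ne_top _ _)
      _ ≤ ∑ y ∈ B, P.real {ω | ∀ p : Fin N × Fin J, Y p.1 p.2 ω = y p} :=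
          MeasureTheory.measureReal_biUnion_finset_le _ _
      _ = ∑ y ∈ B, ∏ p, bernoulliWeight (f (ψs.predictor p.1 p.2)) (y p) :=
          Finset.sum_congr rfl fun y _ => hY.measureReal_eq_prod y
      _ ≤ _ := htail
      _ ≤ _ := by
          refine le_trans (le_of_eq ?_) hbound
          rw [show 2 * (l * L) * C ^ 2 = 2 * l * (L * C ^ 2) by ring]
  -- Subadditivity suffices here, so `G` need not be measurable.
  have hall : (1 : ℝ) ≤ P.real G + P.real Gᶜ := by
    have := MeasureTheory.measureReal_union_le (μ := P) G Gᶜ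
    rwa [Set.union_compl_self, MeasureTheory.probReal_univ] at this
  linarith
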